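/- Let $(\varepsilon_i,\eta_i)$, $i=1,2,\dots$, be i.i.d. pairs of real random variables with mean zero, finite variances $\sigma_\varepsilon^2,\sigma_\eta^2$ and covariance $\sigma_{\varepsilon\eta}$, let $\beta_0,\beta_1,\pi_0,c$ be real, and let the instruments $Z_1,Z_2,\dots$ be fixed real numbers. For each sample size $n$ and $i\le n$ let $$D_i=\pi_0+\pi_1Z_i+\eta_i,\qquad Y_i=\beta_0+\beta_1D_i+\varepsilon_i,\qquad \pi_1=\frac{c}{\sqrt n}.$$ Let either $\widehat{\mathrm{Cov}}[A,B]=\frac1n\sum_{i\le n}(A_i-\bar A)(B_i-\bar B)$ be the sample covariance or, in the model without intercepts ($\beta_0=\pi_0=0$), alternatively $\widehat{\mathrm{Cov}}[A,B]=\frac1n\sum_{i\le n}A_iB_i$. Suppose $\widehat{\mathrm{Cov}}[Z,Z]\to1$ as $n\to\infty$, and let $$\hat\beta_{2SLS}=\frac{\widehat{\mathrm{Cov}}[Y,Z]}{\widehat{\mathrm{Cov}}[D,Z]}.$$ Then the following hold. 1. $\sqrt n\,\bigl(\widehat{\mathrm{Cov}}[Y,Z],\widehat{\mathrm{Cov}}[D,Z]\bigr)$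 converges in distribution to $(V_0,V_1)\sim\mathcal N\bigl((c\beta_1,c),\Sigma\bigr)$, where the matrix $$\Sigma=\begin{pmatrix}\beta_1^2\sigma_\eta^2+\sigma_\varepsilon^2+2\beta_1\sigma_{\varepsilon\eta}&\beta_1\sigma_\eta^2+\sigma_{\varepsilon\eta}\\ \beta_1\sigma_\eta^2+\sigma_{\varepsilon\eta}&\sigma_\eta^2\end{pmatrix}$$ is positive semidefinite. 2. If $\sigma_\eta^2>0$ or $c\ne0$, then $P(\widehat{\mathrm{Cov}}[D,Z]=0)\to0$, $V_1\neq0$ almost surely, and $\hat\beta_{2SLS}$ converges in distribution to the ratio $V_0/V_1$ of jointly normal variables. 3. If $c=0$ and $\sigma_{\varepsilon\eta}^2<\sigma_\varepsilon^2\sigma_\eta^2$, then $V_0/V_1$ has the Cauchy distribution with location $\beta_1+\sigma_{\varepsilon\eta}/\sigma_\eta^2$ and scale $\sqrt{\sigma_\varepsilon^2\sigma_\eta^2-\sigma_{\varepsilon\eta}^2}/\sigma_\eta^2$. 4. If $\sigma_\varepsilon^2>0$, and $\sigma_\eta^2>0$ or $c\ne0$, then $\sqrt n(\hat\beta_{2SLS}-\beta_1)$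 diverges: $P\bigl(|\sqrt n(\hat\beta_{2SLS}-\beta_1)|\le M\bigr)\to0$ for every real $M$, and $\sqrt n(\hat\beta_{2SLS}-\beta_1)$ does not converge in distribution to any probability law on $\mathbb R$. -/

import Mathlib

open MeasureTheory ProbabilityTheory Filter
open scoped Topology

namespace WeakIV

/-- The sample mean of the first `n` observations. -/
noncomputable def sampleMean (n : ℕ) (x : ℕ → ℝ) : ℝ :=
  (∑ i ∈ Finset.range n, x i) / n

/-- The (centred) sample covariance of the first `n` observations. -/
noncomputable def sampleCov (n : ℕ) (x y : ℕ → ℝ) : ℝ :=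
  (∑ i ∈ Finset.range n, (x i - sampleMean n x) * (y i - sampleMean n y)) / n

/-- The uncentred sample cross moment of the first `n` observations, which plays the role of the
sample covariance in the model without intercepts. -/
noncomputable def sampleMoment (n : ℕ) (x y : ℕ → ℝ) : ℝ :=
  (∑ i ∈ Finset.range n, x i * y i) / n

/-- The endogenous variable `D_i = π₀ + π₁ Z_i + η_i` in the sample of size `n`, with the weak
first stage `π₁ = c / √n`. -/
noncomputable def regressor {Ω : Type*} (π₀ c : ℝ) (Z : ℕ → ℝ) (η : ℕ → Ω → ℝ)
    (n : ℕ) (ω : Ω) (i : ℕ) : ℝ :=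
  π₀ + c / √(n : ℝ) * Z i + η i ω

/-- The outcome `Y_i = β₀ + β₁ D_i + ε_i` in the sample of size `n`. -/
noncomputable def outcome {Ω : Type*} (β₀ β₁ π₀ c : ℝ) (Z : ℕ → ℝ) (ε η : ℕ → Ω → ℝ)
    (n : ℕ) (ω : Ω) (i : ℕ) : ℝ :=
  β₀ + β₁ * regressor π₀ c Z η n ω i + ε i ω

/-- The just-identified two-stage least squares estimator
`Ĉov[Y, Z] / Ĉov[D, Z]` for the sample covariance functional `cov`. -/
noncomputable def twoSLS (cov : ℕ → (ℕ → ℝ) → (ℕ → ℝ) → ℝ) (n : ℕ) (Y D Z : ℕ → ℝ) : ℝ :=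
  cov n Y Z / cov n D Z

/-- The asymptotic covariance matrix of `√n (Ĉov[Y, Z], Ĉov[D, Z])`, in terms of `β₁` and of
the variances `vε`, `vη` and the covariance `vεη` of the two errors. Its upper left entry is
the variance of the reduced form error `β₁ η + ε`. -/
noncomputable def asympCov (β₁ vε vη vεη : ℝ) : Matrix (Fin 2) (Fin 2) ℝ :=
  !![β₁ ^ 2 * vη + vε + 2 * β₁ * vεη, β₁ * vη + vεη; β₁ * vη + vεη, vη]

/-- The bivariate normal law with mean `(c β₁, c)` and covariance matrix `asympCov`. -/
noncomputable def limitLaw (β₁ c vε vη vεη : ℝ) : Measure (EuclideanSpace ℝ (Fin 2)) :=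
  multivariateGaussian !₂[c * β₁, c] (asympCov β₁ vε vη vεη)

instance (β₁ c vε vη vεη : ℝ) : IsProbabilityMeasure (limitLaw β₁ c vε vη vεη) := by
  unfold limitLaw
  infer_instance

end WeakIV

/-! Both covariance functionals have the form `(∑ w n i * x i) / n`, and the intercept terms vanish.
Hence each projection of `√n (Ĉov[Y,Z], Ĉov[D,Z])` is a deterministic drift tending to a multiple of
`c` plus a weighted sum of i.i.d. centred scalars with weights `w n i / √n`. The squares of these
weights sum to `cov n Z Z → 1`, and this convergence alone forces their maximum to tend to zero
(`exists_weights`). A central limit theorem under this condition (`tendsto_charFun_weighted_sum`)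
and Lévy's continuity theorem give the joint normal limit.

The signal in the first stage is thus of the same order as the noise, so the denominator stays
random. The map `v 0 / v 1` is continuous off the line `v 1 = 0`, which the limit law does not
charge, and continuous mapping gives the limit of the estimator. When `c = 0`, regressing `V₀` on
`V₁` writes the ratio as a constant plus a multiple of a quotient of independent standard normals,
which is Cauchy. When `vε > 0`, the limit ratio has no atom at `β₁`, so the error is not small and
multiplication by `√n` drives it to infinity. -/

namespace WeakIV

/-! ### Weights of the sample covariance with a fixed instrument -/

/-- `T (n + 1) / (n + 1)` and `T n / (n + 1)` have the same limit. For `T` a sum of squares, this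
says that the newest term is `o(n)`. -/
lemma tendsto_increment_div {T : ℕ → ℝ} {l : ℝ} (hT : Tendsto (fun n : ℕ => T n / n) atTop (𝓝 l)) :
    Tendsto (fun n : ℕ => (T (n + 1) - T n) / (n + 1)) atTop (𝓝 0) := by
  have h1 : Tendsto (fun n : ℕ => T (n + 1) / ((n : ℝ) + 1)) atTop (𝓝 l) := by
    simpa [Function.comp_def] using hT.comp (tendsto_add_atTop_nat 1)
  have h2 := hT.mul (tendsto_natCast_div_add_atTop (1 : ℝ))
  have h3 := h1.sub h2
  rw [mul_one, sub_self] at h3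
  refine h3.congr' ?_
  filter_upwards [eventually_ne_atTop 0] with n hn
  have : (n : ℝ) ≠ 0 := by exact_mod_cast hn
  field_simp

lemma eventually_abs_le_mul_sqrt_of_tendsto {u : ℕ → ℝ}
    (hu : Tendsto (fun n : ℕ => u n ^ 2 / (n + 1)) atTop (𝓝 0)) {δ : ℝ} (hδ : 0 < δ) :
    ∀ᶠ n : ℕ in atTop, |u n| ≤ δ * √((n : ℝ) + 1) := by
  filter_upwards [hu.eventually_le_const (show 0 < δ ^ 2 by positivity)] with n hn
  rw [div_le_iff₀ (by positivity)] at hn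
  apply abs_le_of_sq_le_sq _ (by positivity)
  rwa [mul_pow, Real.sq_sqrt (by positivity)]

lemma eventually_le_mul_sqrt (C : ℝ) {δ : ℝ} (hδ : 0 < δ) :
    ∀ᶠ n : ℕ in atTop, C ≤ δ * √(n : ℝ) :=
  ((Real.tendsto_sqrt_atTop.comp tendsto_natCast_atTop_atTop).const_mul_atTop
    hδ).eventually_ge_atTop C

/-- The increment bound controls `Z i` for `i ≥ K`; the finitely many earlier values are dominated
by a fixed sum, which `δ√n` eventually exceeds. -/
lemma eventually_forall_abs_le_of_sampleMoment {Z : ℕ → ℝ}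
    (hZ : Tendsto (fun n => sampleMoment n Z Z) atTop (𝓝 1)) {δ : ℝ} (hδ : 0 < δ) :
    ∀ᶠ n : ℕ in atTop, ∀ i < n, |Z i| ≤ δ * √(n : ℝ) := by
  have h := tendsto_increment_div (T := fun n => ∑ i ∈ Finset.range n, Z i * Z i) hZ
  simp only [Finset.sum_range_succ, add_sub_cancel_left, ← pow_two] at h
  obtain ⟨K, hK⟩ := eventually_atTop.1 (eventually_abs_le_mul_sqrt_of_tendsto h hδ)
  filter_upwards [eventually_le_mul_sqrt (∑ i ∈ Finset.range K, |Z i|) hδ] with n hn i hi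
  by_cases hiK : i < K
  · exact (Finset.single_le_sum (f := fun i => |Z i|) (fun _ _ => abs_nonneg _)
      (Finset.mem_range.2 hiK)).trans hn
  · refine (hK i (not_lt.1 hiK)).trans ?_
    gcongr
    exact_mod_cast hi

lemma sum_sub_const_eq (Z : ℕ → ℝ) (n : ℕ) (b : ℝ) :
    ∑ i ∈ Finset.range n, (Z i - b) = n * (sampleMean n Z - b) := by
  rcases eq_or_ne n 0 with rfl | hn
  · simp
  have : (n : ℝ) ≠ 0 := by exact_mod_cast hn
  simp only [sampleMean, Finset.sum_sub_distrib, Finset.sum_const, Finset.card_range, nsmul_eq_mul]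
  field_simp

lemma sum_sub_sampleMean_eq_zero (Z : ℕ → ℝ) (n : ℕ) :
    ∑ i ∈ Finset.range n, (Z i - sampleMean n Z) = 0 := by
  rw [sum_sub_const_eq]; simp

lemma sum_sq_sub_sampleMean (Z : ℕ → ℝ) (n : ℕ) :
    ∑ i ∈ Finset.range n, (Z i - sampleMean n Z) ^ 2 =
      ∑ i ∈ Finset.range n, Z i ^ 2 - n * sampleMean n Z ^ 2 := by
  have h : ∀ i ∈ Finset.range n, (Z i - sampleMean n Z) ^ 2 =
      Z i ^ 2 - 2 * sampleMean n Z * (Z i - sampleMean n Z) - sampleMean n Z ^ 2 := by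
    intro i _; ring
  rw [Finset.sum_congr rfl h, Finset.sum_sub_distrib, Finset.sum_sub_distrib, ← Finset.mul_sum,
    sum_sub_sampleMean_eq_zero]
  simp

/-- Recursive update of the centred sum of squares; it turns the increment bound into one on `Z n -
sampleMean n Z`. -/
lemma sum_sq_sub_sampleMean_succ (Z : ℕ → ℝ) {n : ℕ} (hn : n ≠ 0) :
    ∑ i ∈ Finset.range (n + 1), (Z i - sampleMean (n + 1) Z) ^ 2 -
        ∑ i ∈ Finset.range n, (Z i - sampleMean n Z) ^ 2 =
      n / (n + 1) * (Z n - sampleMean n Z) ^ 2 := by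
  have h : (n : ℝ) ≠ 0 := by exact_mod_cast hn
  have h' : (n : ℝ) + 1 ≠ 0 := by positivity
  rw [sum_sq_sub_sampleMean, sum_sq_sub_sampleMean]
  simp only [sampleMean, Finset.sum_range_succ, Nat.cast_add, Nat.cast_one]
  field_simp
  ring

/-- Cauchy–Schwarz on the first `m` deviations from the mean of all `n`. It bounds the drift of the
running mean. -/
lemma mul_sq_sampleMean_sub_le (Z : ℕ → ℝ) {m n : ℕ} (hmn : m ≤ n) :
    m * (sampleMean m Z - sampleMean n Z) ^ 2 ≤
      ∑ i ∈ Finset.range n, (Z i - sampleMean n Z) ^ 2 := by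
  rcases eq_or_ne m 0 with rfl | hm
  · simpa using Finset.sum_nonneg fun i _ => sq_nonneg _
  have hm' : (0 : ℝ) < m := by positivity
  have h1 := sq_sum_le_card_mul_sum_sq (s := Finset.range m) (f := fun i => Z i - sampleMean n Z)
  rw [sum_sub_const_eq, Finset.card_range] at h1
  have h2 : ∑ i ∈ Finset.range m, (Z i - sampleMean n Z) ^ 2 ≤
      ∑ i ∈ Finset.range n, (Z i - sampleMean n Z) ^ 2 :=
    Finset.sum_le_sum_of_subset_of_nonneg (Finset.range_subset_range.2 hmn)
      fun _ _ _ => sq_nonneg _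
  refine le_trans ?_ h2
  rw [mul_pow, pow_two (m : ℝ), mul_assoc] at h1
  exact le_of_mul_le_mul_left h1 hm'

/-- The centring moves with `n`, so `Z i` is first compared with an earlier mean (`sampleMean i Z`,
or `sampleMean K Z` if `i < K`), and the drift from that mean to `sampleMean n Z` is bounded
separately. Each part costs `δ / 2`. -/
lemma eventually_forall_abs_le_of_sampleCov {Z : ℕ → ℝ}
    (hZ : Tendsto (fun n => sampleCov n Z Z) atTop (𝓝 1)) {δ : ℝ} (hδ : 0 < δ) :
    ∀ᶠ n : ℕ in atTop, ∀ i < n, |Z i - sampleMean n Z| ≤ δ * √(n : ℝ) := by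
  simp only [sampleCov, ← pow_two] at hZ
  have hinc := tendsto_increment_div
    (T := fun n => ∑ i ∈ Finset.range n, (Z i - sampleMean n Z) ^ 2) hZ
  have hu : Tendsto (fun n : ℕ => (Z n - sampleMean n Z) ^ 2 / (n + 1)) atTop (𝓝 0) := by
    have hr := (tendsto_natCast_div_add_atTop (1 : ℝ)).inv₀ one_ne_zero
    have h := hinc.mul hr
    rw [zero_mul] at h
    refine h.congr' ?_
    filter_upwards [eventually_ne_atTop 0] with n hn
    have h0 : (n : ℝ) ≠ 0 := by exact_mod_cast hn
    have h' : (n : ℝ) + 1 ≠ 0 := by positivity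
    rw [sum_sq_sub_sampleMean_succ Z hn]
    field_simp
  have hδ2 : 0 < δ / 2 := by positivity
  -- The centred sum of squares will be at most `2 * n`, so the squared drift from `m ≥ K` is at
  -- most `2 * n / m ≤ (δ / 2) ^ 2 * n`.
  have hK2 : ∀ᶠ K : ℕ in atTop, 2 ≤ (δ / 2) ^ 2 * (K : ℝ) :=
    (tendsto_natCast_atTop_atTop.const_mul_atTop (show 0 < (δ / 2) ^ 2 by
      positivity)).eventually_ge_atTop 2
  obtain ⟨K, hK⟩ := eventually_atTop.1
    ((eventually_abs_le_mul_sqrt_of_tendsto hu hδ2).and hK2)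
  filter_upwards [eventually_le_mul_sqrt (∑ i ∈ Finset.range K, |Z i - sampleMean K Z|) hδ2,
    hZ.eventually_le_const one_lt_two, eventually_ge_atTop K, eventually_gt_atTop 0]
    with n hn hS hKn hn0 i hi
  have hnpos : (0 : ℝ) < n := by exact_mod_cast hn0
  rw [div_le_iff₀ hnpos] at hS
  have hm : ∀ m, K ≤ m → m ≤ n → |sampleMean m Z - sampleMean n Z| ≤ δ / 2 * √(n : ℝ) := by
    intro m hKm hmn
    have h2 := (hK m hKm).2
    have hmpos : (0 : ℝ) < m := by
      by_contra h
      nlinarith [sq_nonneg (δ / 2)]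
    have h1 := (mul_sq_sampleMean_sub_le Z hmn).trans hS
    apply abs_le_of_sq_le_sq _ (by positivity)
    rw [mul_pow, Real.sq_sqrt hnpos.le]
    have h3 := h1.trans (mul_le_mul_of_nonneg_right h2 hnpos.le)
    refine le_of_mul_le_mul_left (h3.trans_eq ?_) hmpos
    ring
  have key : ∀ m, K ≤ m → m ≤ n → |Z i - sampleMean m Z| ≤ δ / 2 * √(n : ℝ) →
      |Z i - sampleMean n Z| ≤ δ * √(n : ℝ) := by
    intro m hKm hmn h
    have := abs_sub_le (Z i) (sampleMean m Z) (sampleMean n Z)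
    linarith [hm m hKm hmn]
  by_cases hiK : i < K
  · exact key K le_rfl hKn ((Finset.single_le_sum (f := fun i => |Z i - sampleMean K Z|)
      (fun _ _ => abs_nonneg _) (Finset.mem_range.2 hiK)).trans hn)
  · refine key i (not_lt.1 hiK) hi.le (((hK i (not_lt.1 hiK)).1).trans ?_)
    gcongr
    exact_mod_cast hi

/-- Centring one factor suffices, because the centred weights sum to zero. -/
lemma sampleCov_eq_sum_mul (n : ℕ) (x Z : ℕ → ℝ) :
    sampleCov n x Z = (∑ i ∈ Finset.range n, (Z i - sampleMean n Z) * x i) / n := by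
  have h : ∀ i ∈ Finset.range n, (x i - sampleMean n x) * (Z i - sampleMean n Z) =
      (Z i - sampleMean n Z) * x i - sampleMean n x * (Z i - sampleMean n Z) := by
    intro i _; ring
  rw [sampleCov, Finset.sum_congr rfl h, Finset.sum_sub_distrib, ← Finset.mul_sum,
    sum_sub_sampleMean_eq_zero]
  simp

/-- Both covariance functionals are weighted sums whose weights satisfy Noether's condition. -/
lemma exists_weights {cov : ℕ → (ℕ → ℝ) → (ℕ → ℝ) → ℝ} {β₀ π₀ : ℝ} {Z : ℕ → ℝ}
    (hcov : cov = sampleCov ∨ (cov = sampleMoment ∧ β₀ = 0 ∧ π₀ = 0))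
    (hZ : Tendsto (fun n => cov n Z Z) atTop (𝓝 1)) :
    ∃ w : ℕ → ℕ → ℝ,
      (∀ n x, cov n x Z = (∑ i ∈ Finset.range n, w n i * x i) / n) ∧
      (∀ n, cov n Z Z = (∑ i ∈ Finset.range n, w n i ^ 2) / n) ∧
      (∀ n, β₀ * ∑ i ∈ Finset.range n, w n i = 0) ∧
      (∀ n, π₀ * ∑ i ∈ Finset.range n, w n i = 0) ∧
      ∀ δ > 0, ∀ᶠ n : ℕ in atTop, ∀ i < n, |w n i| ≤ δ * √(n : ℝ) := by
  rcases hcov with rfl | ⟨rfl, rfl, rfl⟩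
  · refine ⟨fun n i => Z i - sampleMean n Z, fun n x => sampleCov_eq_sum_mul n x Z, fun n => ?_,
      fun n => ?_, fun n => ?_, fun δ hδ => eventually_forall_abs_le_of_sampleCov hZ hδ⟩
    · simp [sampleCov, pow_two]
    · simp only [sum_sub_sampleMean_eq_zero, mul_zero]
    · simp only [sum_sub_sampleMean_eq_zero, mul_zero]
  · refine ⟨fun _ i => Z i, fun n x => ?_, fun n => ?_, by simp, by simp,
      fun δ hδ => eventually_forall_abs_le_of_sampleMoment hZ hδ⟩
    · simp [sampleMoment, mul_comm]
    · simp [sampleMoment, pow_two]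

/-! ### A weighted central limit theorem for characteristic functions -/

lemma norm_prod_sub_prod_le_sum {ι : Type*} (s : Finset ι) (f g : ι → ℂ)
    (hf : ∀ i ∈ s, ‖f i‖ ≤ 1) (hg : ∀ i ∈ s, ‖g i‖ ≤ 1) :
    ‖∏ i ∈ s, f i - ∏ i ∈ s, g i‖ ≤ ∑ i ∈ s, ‖f i - g i‖ := by
  classical
  induction s using Finset.induction_on with
  | empty => simp
  | insert a s ha ih =>
    rw [Finset.prod_insert ha, Finset.prod_insert ha, Finset.sum_insert ha]
    have hf' : ∀ i ∈ s, ‖f i‖ ≤ 1 := fun i hi => hf i (Finset.mem_insert_of_mem hi)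
    have hg' : ∀ i ∈ s, ‖g i‖ ≤ 1 := fun i hi => hg i (Finset.mem_insert_of_mem hi)
    have h1 : ‖∏ i ∈ s, g i‖ ≤ 1 := by
      rw [norm_prod]
      exact Finset.prod_le_one (fun _ _ => norm_nonneg _) hg'
    have h2 := hf a (Finset.mem_insert_self _ _)
    have : f a * ∏ i ∈ s, f i - g a * ∏ i ∈ s, g i =
        f a * (∏ i ∈ s, f i - ∏ i ∈ s, g i) + (f a - g a) * ∏ i ∈ s, g i := by ring
    rw [this, add_comm ‖f a - g a‖]
    refine (norm_add_le _ _).trans (add_le_add ?_ ?_)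
    · rw [norm_mul]
      exact (mul_le_of_le_one_left (norm_nonneg _) h2).trans (ih hf' hg')
    · rw [norm_mul]
      exact mul_le_of_le_one_right (norm_nonneg _) h1

variable {Ω : Type*} [MeasurableSpace Ω] {P : Measure Ω} [IsProbabilityMeasure P]

/-- Both functions have the second-order expansion `1 - v t² / 2` at zero. -/
lemma charFun_sub_exp_isLittleO {X : Ω → ℝ} (hX : MemLp X 2 P) (h0 : ∫ ω, X ω ∂P = 0) :
    (fun t : ℝ => charFun (P.map X) t - Complex.exp ((-(∫ ω, X ω ^ 2 ∂P) * t ^ 2 / 2 : ℝ)))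
      =o[𝓝 0] fun t => t ^ 2 := by
  have hXm : AEMeasurable X P := hX.aestronglyMeasurable.aemeasurable
  have hint : MemLp id 2 (P.map X) := by
    rw [memLp_map_measure_iff (by fun_prop) hXm]
    exact hX
  have : IsProbabilityMeasure (P.map X) := Measure.isProbabilityMeasure_map hXm
  have h1 := taylor_isLittleO_univ (x₀ := (0 : ℝ)) (contDiff_charFun hint)
  set v := ∫ ω, X ω ^ 2 ∂P with hv
  have h2 : (fun t : ℝ => charFun (P.map X) t - (1 - (v : ℂ) * t ^ 2 / 2)) =o[𝓝 0]
      fun t => t ^ 2 := by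
    convert! h1 using 2 with t
    · rw [taylorWithinEval_charFun_two_zero hXm hint, h0]
      simp [hv]
    · simp
  have h3 : (fun t : ℝ => Complex.exp ((-v * t ^ 2 / 2 : ℝ)) - (1 - (v : ℂ) * t ^ 2 / 2)) =o[𝓝 0]
      fun t => t ^ 2 := by
    have hd := (Complex.hasDerivAt_exp 0).isLittleO
    have hc : Tendsto (fun t : ℝ => ((-v * t ^ 2 / 2 : ℝ) : ℂ)) (𝓝 0) (𝓝 0) := by
      have : Continuous (fun t : ℝ => ((-v * t ^ 2 / 2 : ℝ) : ℂ)) := by fun_prop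
      simpa using this.tendsto 0
    have h := hd.comp_tendsto hc
    have hO : (fun t : ℝ => ((-v * t ^ 2 / 2 : ℝ) : ℂ)) =O[𝓝 0] fun t : ℝ => t ^ 2 := by
      refine Asymptotics.IsBigO.of_bound (|v| / 2) (Eventually.of_forall fun t => ?_)
      rw [Complex.norm_real]
      simp only [abs_div, abs_mul, abs_neg, norm_pow, Real.norm_eq_abs, abs_pow, Nat.abs_ofNat]
      apply le_of_eq; ring
    refine Asymptotics.IsLittleO.trans_isBigO ?_ hO
    convert! h using 2 with t
    · simp; ring
    · simp
  simpa using h2.sub h3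

/-- Characteristic function form of the central limit theorem for weighted sums of i.i.d. centred
variables, under Noether's condition on the weights. -/
theorem tendsto_charFun_weighted_sum {ξ : ℕ → Ω → ℝ} (hindep : iIndepFun ξ P)
    (hident : ∀ i, IdentDistrib (ξ i) (ξ 0) P P) (hξ : MemLp (ξ 0) 2 P)
    (h0 : ∫ ω, ξ 0 ω ∂P = 0) {a : ℕ → ℕ → ℝ}
    (ha : Tendsto (fun n => ∑ i ∈ Finset.range n, a n i ^ 2) atTop (𝓝 1))
    (hmax : ∀ δ > 0, ∀ᶠ n : ℕ in atTop, ∀ i < n, |a n i| ≤ δ) :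
    Tendsto (fun n => charFun (P.map fun ω => ∑ i ∈ Finset.range n, a n i * ξ i ω) 1) atTop
      (𝓝 (Complex.exp ((-(∫ ω, ξ 0 ω ^ 2 ∂P) / 2 : ℝ)))) := by
  have hm : ∀ i, AEMeasurable (ξ i) P := fun i => (hident i).aemeasurable_fst
  set φ := charFun (P.map (ξ 0)) with hφ
  set v := ∫ ω, ξ 0 ω ^ 2 ∂P with hv
  have hv0 : 0 ≤ v := integral_nonneg fun ω => sq_nonneg _
  have hprob : IsProbabilityMeasure (P.map (ξ 0)) := Measure.isProbabilityMeasure_map (hm 0)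
  have hprod : ∀ n, charFun (P.map fun ω => ∑ i ∈ Finset.range n, a n i * ξ i ω) 1 =
      ∏ i ∈ Finset.range n, φ (a n i) := by
    intro n
    have hi : iIndepFun (fun i ω => a n i * ξ i ω) P :=
      hindep.comp (fun i x => a n i * x) (fun i => by fun_prop)
    rw [(hi.restrict _).charFun_map_fun_finsetSum_eq_prod (fun i _ => (hm i).const_mul _),
      Finset.prod_apply]
    refine Finset.prod_congr rfl fun i _ => ?_
    rw [charFun_map_mul_comp (hm i), mul_one, (hident i).map_eq]
  simp_rw [hprod]
  have hexp : Tendsto (fun n => Complex.exp ((-v * (∑ i ∈ Finset.range n, a n i ^ 2) / 2 : ℝ)))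
      atTop (𝓝 (Complex.exp ((-v / 2 : ℝ)))) := by
    have hc : Continuous fun s : ℝ => Complex.exp ((-v * s / 2 : ℝ)) := by fun_prop
    simpa [Function.comp_def] using (hc.tendsto 1).comp ha
  have hexp_prod : ∀ n, Complex.exp ((-v * (∑ i ∈ Finset.range n, a n i ^ 2) / 2 : ℝ)) =
      ∏ i ∈ Finset.range n, Complex.exp ((-v * a n i ^ 2 / 2 : ℝ)) := by
    intro n
    rw [← Complex.exp_sum, ← Complex.ofReal_sum, Finset.mul_sum, Finset.sum_div]
  suffices h : Tendsto (fun n => ∏ i ∈ Finset.range n, φ (a n i) -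
      Complex.exp ((-v * (∑ i ∈ Finset.range n, a n i ^ 2) / 2 : ℝ))) atTop (𝓝 0) by
    simpa using h.add hexp
  rw [Metric.tendsto_nhds]
  intro e he
  -- The squared weights eventually sum to at most `2`, so `e / 4` per unit leaves a total error of
  -- at most `e / 2`.
  have hlo := (charFun_sub_exp_isLittleO hξ h0).def (show 0 < e / 4 by positivity)
  obtain ⟨δ, hδ, hball⟩ := Metric.eventually_nhds_iff.1 hlo
  filter_upwards [hmax (δ / 2) (by positivity), ha.eventually_le_const one_lt_two] with n hn hsum
  rw [dist_zero_right, hexp_prod]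
  refine (norm_prod_sub_prod_le_sum _ _ _ (fun i _ => norm_charFun_le_one _) ?_).trans_lt ?_
  · intro i _
    rw [Complex.norm_exp, Complex.ofReal_re, Real.exp_le_one_iff]
    nlinarith [mul_nonneg hv0 (sq_nonneg (a n i))]
  · have hle : ∑ i ∈ Finset.range n, ‖φ (a n i) - Complex.exp ((-v * a n i ^ 2 / 2 : ℝ))‖ ≤
        ∑ i ∈ Finset.range n, e / 4 * a n i ^ 2 := by
      refine Finset.sum_le_sum fun i hi => ?_
      have := hball (y := a n i) (by
        rw [dist_zero_right, Real.norm_eq_abs]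
        linarith [hn i (Finset.mem_range.1 hi)])
      simpa using this
    rw [← Finset.mul_sum] at hle
    nlinarith

/-! ### Consequences of convergence in distribution -/

section ConvergenceInDistribution

variable {ι E Ω' : Type*} {Ω : ι → Type*} {m : ∀ i, MeasurableSpace (Ω i)}
  {μ : (i : ι) → Measure (Ω i)} [∀ i, IsProbabilityMeasure (μ i)]
  [MeasurableSpace Ω'] {μ' : Measure Ω'} [IsProbabilityMeasure μ']
  [TopologicalSpace E] [HasOuterApproxClosed E] [MeasurableSpace E] [BorelSpace E]
  {l : Filter ι} {X : (i : ι) → Ω i → E} {Z : Ω' → E}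

lemma le_liminf_measure_preimage_of_isOpen (h : TendstoInDistribution X l Z μ μ') {G : Set E}
    (hG : IsOpen G) : μ' (Z ⁻¹' G) ≤ l.liminf fun i => μ i (X i ⁻¹' G) := by
  have := ProbabilityMeasure.le_liminf_measure_open_of_tendsto h.tendsto hG
  simp only [ProbabilityMeasure.coe_mk] at this
  rw [Measure.map_apply_of_aemeasurable h.aemeasurable_limit hG.measurableSet] at this
  simpa only [Measure.map_apply_of_aemeasurable (h.forall_aemeasurable _) hG.measurableSet]
    using this

lemma limsup_measure_preimage_le_of_isClosed (h : TendstoInDistribution X l Z μ μ') {C : Set E}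
    (hC : IsClosed C) : l.limsup (fun i => μ i (X i ⁻¹' C)) ≤ μ' (Z ⁻¹' C) := by
  have := ProbabilityMeasure.limsup_measure_closed_le_of_tendsto h.tendsto hC
  simp only [ProbabilityMeasure.coe_mk] at this
  rw [Measure.map_apply_of_aemeasurable h.aemeasurable_limit hC.measurableSet] at this
  simpa only [Measure.map_apply_of_aemeasurable (h.forall_aemeasurable _) hC.measurableSet]
    using this

lemma tendsto_measure_preimage_zero_of_isClosed (h : TendstoInDistribution X l Z μ μ') {C : Set E}
    (hC : IsClosed C) (h0 : μ' (Z ⁻¹' C) = 0) :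
    Tendsto (fun i => μ i (X i ⁻¹' C)) l (𝓝 0) :=
  tendsto_of_le_liminf_of_limsup_le bot_le
    ((limsup_measure_preimage_le_of_isClosed h hC).trans h0.le)

/-- **Continuous mapping theorem** for a measurable map that is continuous on an open set of full
limiting measure. -/
theorem TendstoInDistribution.comp_of_continuousOn [l.IsCountablyGenerated]
    {F : Type*} [TopologicalSpace F] [MeasurableSpace F] [BorelSpace F]
    (h : TendstoInDistribution X l Z μ μ')
    {g : E → F} (hg : Measurable g) {U : Set E} (hU : IsOpen U) (hgU : ContinuousOn g U)
    (h0 : μ' (Z ⁻¹' Uᶜ) = 0) :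
    TendstoInDistribution (fun i => g ∘ X i) l (g ∘ Z) μ μ' where
  forall_aemeasurable i := hg.comp_aemeasurable (h.forall_aemeasurable i)
  aemeasurable_limit := hg.comp_aemeasurable h.aemeasurable_limit
  tendsto := by
    refine tendsto_of_forall_isOpen_le_liminf' fun G hG => ?_
    simp only [ProbabilityMeasure.coe_mk]
    rw [Measure.map_apply_of_aemeasurable (hg.comp_aemeasurable h.aemeasurable_limit)
      hG.measurableSet]
    simp only [Measure.map_apply_of_aemeasurable (hg.comp_aemeasurable (h.forall_aemeasurable _))
      hG.measurableSet]
    -- `g ⁻¹' G` itself need not be open; its trace on `U` is, and loses no limiting mass.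
    have hopen : IsOpen (U ∩ g ⁻¹' G) := hgU.isOpen_inter_preimage hU hG
    calc μ' (g ∘ Z ⁻¹' G) ≤ μ' (Z ⁻¹' (U ∩ g ⁻¹' G) ∪ Z ⁻¹' Uᶜ) := by
          refine measure_mono fun x hx => ?_
          by_cases hxU : Z x ∈ U
          · exact Or.inl ⟨hxU, hx⟩
          · exact Or.inr hxU
      _ ≤ μ' (Z ⁻¹' (U ∩ g ⁻¹' G)) + μ' (Z ⁻¹' Uᶜ) := measure_union_le _ _
      _ = μ' (Z ⁻¹' (U ∩ g ⁻¹' G)) := by rw [h0, add_zero]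
      _ ≤ l.liminf fun i => μ i (X i ⁻¹' (U ∩ g ⁻¹' G)) :=
          le_liminf_measure_preimage_of_isOpen h hopen
      _ ≤ l.liminf fun i => μ i (g ∘ X i ⁻¹' G) :=
          liminf_le_liminf (Eventually.of_forall fun i => measure_mono fun x hx => hx.2)

end ConvergenceInDistribution

section Divergence

variable {Ω Ω' : Type*} [MeasurableSpace Ω] {P : Measure Ω} [IsProbabilityMeasure P]
  [MeasurableSpace Ω'] {μ : Measure Ω'} [IsProbabilityMeasure μ]

lemma exists_measure_abs_sub_le_lt {g : Ω' → ℝ} (hg : AEMeasurable g μ) {b : ℝ}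
    (hb : μ {v | g v = b} = 0) {e : ENNReal} (he : 0 < e) :
    ∃ δ > 0, μ {v | |g v - b| ≤ δ} < e := by
  have hlim : Tendsto (fun k : ℕ => μ {v | |g v - b| ≤ 1 / ((k : ℝ) + 1)}) atTop
      (𝓝 (μ (⋂ k : ℕ, {v | |g v - b| ≤ 1 / ((k : ℝ) + 1)}))) := by
    refine tendsto_measure_iInter_atTop (fun k => ?_) (fun i j hij v hv => ?_)
      ⟨0, measure_ne_top _ _⟩
    · exact nullMeasurableSet_le (by fun_prop) (by fun_prop)
    · have hv' : |g v - b| ≤ 1 / ((j : ℝ) + 1) := hv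
      refine hv'.trans (one_div_le_one_div_of_le (by positivity) ?_)
      gcongr
  have hsub : (⋂ k : ℕ, {v | |g v - b| ≤ 1 / ((k : ℝ) + 1)}) ⊆ {v | g v = b} := by
    intro v hv
    have hv' : ∀ k : ℕ, |g v - b| ≤ 1 / ((k : ℝ) + 1) := by simpa using hv
    have := ge_of_tendsto' tendsto_one_div_add_atTop_nhds_zero_nat hv'
    exact sub_eq_zero.1 (abs_nonpos_iff.1 this)
  rw [measure_mono_null hsub hb] at hlim
  obtain ⟨k, hk⟩ := (hlim.eventually_lt_const he).exists
  exact ⟨_, by positivity, hk⟩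

/-- Once `δ√n ≥ M`, the event lies in `|R n - b| ≤ δ`, a closed condition whose limiting mass is
small because `g` has no atom at `b`. -/
lemma tendsto_measure_abs_sqrt_mul_sub_le {R : ℕ → Ω → ℝ} {g : Ω' → ℝ} {b : ℝ}
    (h : TendstoInDistribution R atTop g (fun _ => P) μ) (hb : μ {v | g v = b} = 0) (M : ℝ) :
    Tendsto (fun n : ℕ => P {ω | |√(n : ℝ) * (R n ω - b)| ≤ M}) atTop (𝓝 0) := by
  rw [ENNReal.tendsto_nhds_zero]
  intro e he
  obtain ⟨δ, hδ, hlt⟩ := exists_measure_abs_sub_le_lt h.aemeasurable_limit hb he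
  have hC : IsClosed {x : ℝ | |x - b| ≤ δ} := isClosed_le (by fun_prop) continuous_const
  have hls := (limsup_measure_preimage_le_of_isClosed h hC).trans_lt hlt
  have hsqrt := (Real.tendsto_sqrt_atTop.comp tendsto_natCast_atTop_atTop).const_mul_atTop hδ
  filter_upwards [eventually_lt_of_limsup_lt hls, hsqrt.eventually_ge_atTop M,
    eventually_gt_atTop 0] with n hn hM hn0
  refine (measure_mono fun ω hω => ?_).trans hn.le
  have hs : 0 < √(n : ℝ) := Real.sqrt_pos.2 (by exact_mod_cast hn0)
  have hω' : |√(n : ℝ) * (R n ω - b)| ≤ M := hω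
  rw [abs_mul, abs_of_pos hs, mul_comm] at hω'
  exact le_of_mul_le_mul_right (hω'.trans hM) hs

/-- A limit law would give mass zero to every ball, and balls exhaust the line. -/
lemma not_tendstoInDistribution_of_escape {X : ℕ → Ω → ℝ}
    (h : ∀ M : ℝ, Tendsto (fun n : ℕ => P {ω | |X n ω| ≤ M}) atTop (𝓝 0))
    (ν : Measure ℝ) [IsProbabilityMeasure ν] :
    ¬ TendstoInDistribution X atTop id (fun _ => P) ν := by
  intro hX
  have hball : ∀ k : ℕ, ν (Metric.ball 0 k) = 0 := by
    intro k
    refine le_antisymm ((le_liminf_measure_preimage_of_isOpen hX Metric.isOpen_ball).trans ?_)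
      zero_le
    rw [← (h k).liminf_eq]
    refine liminf_le_liminf (Eventually.of_forall fun n => measure_mono fun ω hω => ?_)
    have : X n ω ∈ Metric.ball (0 : ℝ) k := hω
    rw [mem_ball_zero_iff, Real.norm_eq_abs] at this
    exact this.le
  have := measure_iUnion_null hball
  rw [Metric.iUnion_ball_nat, measure_univ] at this
  exact one_ne_zero this

end Divergence

/-! ### The ratio of normal variables -/

lemma integral_abs_mul_exp_neg_mul_sq {b : ℝ} (hb : 0 < b) :
    ∫ y : ℝ, |y| * Real.exp (-b * y ^ 2) = b⁻¹ := by
  have h := integral_comp_abs (f := fun y : ℝ => y * Real.exp (-b * y ^ 2))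
  simp only [sq_abs] at h
  rw [h]
  have h2 := integral_rpow_mul_exp_neg_mul_rpow (p := 2) (q := 1) two_pos (by norm_num) hb
  norm_num at h2
  rw [Real.rpow_neg_one] at h2
  simp only [neg_mul]
  rw [h2]
  ring

lemma integrable_abs_mul_exp_neg_mul_sq {b : ℝ} (hb : 0 < b) :
    Integrable fun y : ℝ => |y| * Real.exp (-b * y ^ 2) := by
  refine (integrable_mul_exp_neg_mul_sq hb).norm.congr (Eventually.of_forall fun y => ?_)
  simp

/-- Given the denominator `y`, the ratio is normal with standard deviation `γ / |y|`; this is the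
joint density of denominator and ratio. -/
lemma gaussianPDF_mul_gaussianPDF_scale (x₀ : ℝ) {γ : ℝ} (hγ : 0 < γ) (y u : ℝ) :
    gaussianPDF 0 1 y * gaussianPDF x₀ ((γ / y) ^ 2).toNNReal u =
      ENNReal.ofReal ((2 * Real.pi * γ)⁻¹ *
        (|y| * Real.exp (-((1 + ((u - x₀) / γ) ^ 2) / 2) * y ^ 2))) := by
  rw [gaussianPDF, gaussianPDF, ← ENNReal.ofReal_mul (gaussianPDFReal_nonneg _ _ _)]
  congr 1
  rw [gaussianPDFReal, gaussianPDFReal, Real.coe_toNNReal _ (sq_nonneg _)]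
  -- At `y = 0`, division by zero makes the variance zero, and both sides vanish.
  rcases eq_or_ne y 0 with rfl | hy
  · simp
  have h1 : √(2 * Real.pi * (γ / y) ^ 2) = √(2 * Real.pi) * (γ / |y|) := by
    rw [Real.sqrt_mul (by positivity), Real.sqrt_sq_eq_abs, abs_div, abs_of_pos hγ]
  have h2 : √(2 * Real.pi) * √(2 * Real.pi) = 2 * Real.pi := Real.mul_self_sqrt (by positivity)
  have h3 : Real.exp (-((1 + ((u - x₀) / γ) ^ 2) / 2) * y ^ 2) =
      Real.exp (-(y - 0) ^ 2 / (2 * 1)) * Real.exp (-(u - x₀) ^ 2 / (2 * (γ / y) ^ 2)) := by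
    rw [← Real.exp_add]
    congr 1
    field_simp
    ring
  have h4 : 0 < √(2 * Real.pi) := by positivity
  have hy' : |y| ≠ 0 := abs_ne_zero.2 hy
  rw [h1, h3, NNReal.coe_one, mul_one]
  generalize √(2 * Real.pi) = r at *
  rw [← h2]
  field_simp

lemma lintegral_gaussianPDF_mul_gaussianPDF_scale (x₀ : ℝ) {γ : ℝ} (hγ : 0 < γ) (u : ℝ) :
    ∫⁻ y, ENNReal.ofReal ((2 * Real.pi * γ)⁻¹ *
        (|y| * Real.exp (-((1 + ((u - x₀) / γ) ^ 2) / 2) * y ^ 2))) =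
      cauchyPDF x₀ γ.toNNReal u := by
  have hb : 0 < (1 + ((u - x₀) / γ) ^ 2) / 2 := by positivity
  rw [← ofReal_integral_eq_lintegral_ofReal
    ((integrable_abs_mul_exp_neg_mul_sq hb).const_mul _)
    (Eventually.of_forall fun y => by positivity), integral_const_mul,
    integral_abs_mul_exp_neg_mul_sq hb, cauchyPDF, cauchyPDFReal_def', NNReal.coe_inv,
    Real.coe_toNNReal _ hγ.le]
  congr 1
  field_simp

/-- An affine image of the ratio of two independent standard normal variables is Cauchy. -/
theorem map_ratio_gaussianReal_prod (x₀ : ℝ) {γ : ℝ} (hγ : 0 < γ) :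
    ((gaussianReal 0 1).prod (gaussianReal 0 1)).map (fun p : ℝ × ℝ => x₀ + γ / p.1 * p.2) =
      cauchyMeasure x₀ γ.toNNReal := by
  have hγ' : γ.toNNReal ≠ 0 := by simpa using hγ
  have hmeas : Measurable fun p : ℝ × ℝ => x₀ + γ / p.1 * p.2 := by fun_prop
  ext A hA
  rw [cauchyMeasure_of_scale_ne_zero _ hγ', withDensity_apply _ hA, Measure.map_apply hmeas hA,
    Measure.prod_apply (hmeas hA), gaussianReal_of_var_ne_zero _ one_ne_zero,
    lintegral_withDensity_eq_lintegral_mul₀ (by fun_prop)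
      (measurable_measure_prodMk_left (hmeas hA)).aemeasurable]
  have hinner : ∀ᵐ y : ℝ, (gaussianPDF 0 1 * fun y => (volume.withDensity (gaussianPDF 0 1))
      (Prod.mk y ⁻¹' ((fun p : ℝ × ℝ => x₀ + γ / p.1 * p.2) ⁻¹' A))) y =
      ∫⁻ u in A, ENNReal.ofReal ((2 * Real.pi * γ)⁻¹ *
        (|y| * Real.exp (-((1 + ((u - x₀) / γ) ^ 2) / 2) * y ^ 2))) := by
    filter_upwards [compl_mem_ae_iff.2 (measure_singleton (0 : ℝ))] with y hy
    have hy0 : y ≠ 0 := hy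
    have hmap : ((gaussianReal 0 1).map (γ / y * ·)).map (x₀ + ·) =
        gaussianReal x₀ ((γ / y) ^ 2).toNNReal := by
      rw [gaussianReal_map_const_mul, gaussianReal_map_const_add]
      congr 1
      · simp
      · rw [mul_one]; ext; simp [sq_nonneg]
    have hv : ((γ / y) ^ 2).toNNReal ≠ 0 := by
      rw [Ne, Real.toNNReal_eq_zero, not_le]; positivity
    rw [Pi.mul_apply, ← gaussianReal_of_var_ne_zero _ one_ne_zero]
    have : (gaussianReal 0 1) (Prod.mk y ⁻¹' ((fun p : ℝ × ℝ => x₀ + γ / p.1 * p.2) ⁻¹' A)) =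
        gaussianReal x₀ ((γ / y) ^ 2).toNNReal A := by
      rw [← hmap, Measure.map_map (by fun_prop) (by fun_prop),
        Measure.map_apply (by fun_prop) hA]
      rfl
    rw [this, gaussianReal_apply _ hv, ← lintegral_const_mul _ (by fun_prop)]
    simp_rw [gaussianPDF_mul_gaussianPDF_scale x₀ hγ]
  -- Integrating out the denominator first leaves the Cauchy density.
  rw [lintegral_congr_ae hinner, lintegral_lintegral_swap (by fun_prop)]
  simp_rw [lintegral_gaussianPDF_mul_gaussianPDF_scale x₀ hγ]

/-! ### The limiting normal law -/

/-- The form is the variance of `x 0 * ε + (β₁ * x 0 + x 1) * η`, which is why positivity reduces to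
that of the error covariance. -/
lemma dotProduct_asympCov_mulVec (β₁ vε vη vεη : ℝ) (x : Fin 2 → ℝ) :
    x ⬝ᵥ (asympCov β₁ vε vη vεη).mulVec x =
      x 0 ^ 2 * vε + 2 * x 0 * (β₁ * x 0 + x 1) * vεη + (β₁ * x 0 + x 1) ^ 2 * vη := by
  simp [asympCov, dotProduct, Matrix.mulVec, Fin.sum_univ_two]
  ring

lemma asympCov_posSemidef {β₁ vε vη vεη : ℝ}
    (h : ∀ p q : ℝ, 0 ≤ p ^ 2 * vε + 2 * p * q * vεη + q ^ 2 * vη) :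
    (asympCov β₁ vε vη vεη).PosSemidef := by
  refine Matrix.PosSemidef.of_dotProduct_mulVec_nonneg ?_ fun x => ?_
  · ext i j
    fin_cases i <;> fin_cases j <;> simp [asympCov]
  · rw [star_trivial, dotProduct_asympCov_mulVec]
    exact h _ _

lemma charFun_limitLaw {β₁ c vε vη vεη : ℝ} (hS : (asympCov β₁ vε vη vεη).PosSemidef)
    (t : EuclideanSpace ℝ (Fin 2)) :
    charFun (limitLaw β₁ c vε vη vεη) t =
      Complex.exp (((β₁ * t 0 + t 1) * c : ℝ) * Complex.I) *
        Complex.exp ((-(t 0 ^ 2 * vε + 2 * t 0 * (β₁ * t 0 + t 1) * vεη +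
          (β₁ * t 0 + t 1) ^ 2 * vη) / 2 : ℝ)) := by
  rw [limitLaw, charFun_multivariateGaussian hS, dotProduct_asympCov_mulVec, ← Complex.exp_add]
  congr 1
  simp [PiLp.inner_apply, Fin.sum_univ_two]
  ring

lemma limitLaw_map_linear {β₁ c vε vη vεη : ℝ} (hS : (asympCov β₁ vε vη vεη).PosSemidef)
    (a b : ℝ) :
    (limitLaw β₁ c vε vη vεη).map (fun v => a * v 0 + b * v 1) =
      gaussianReal ((β₁ * a + b) * c)
        (a ^ 2 * vε + 2 * a * (β₁ * a + b) * vεη + (β₁ * a + b) ^ 2 * vη).toNNReal := by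
  have hm : Measurable fun v : EuclideanSpace ℝ (Fin 2) => a * v 0 + b * v 1 := by fun_prop
  have := Measure.isProbabilityMeasure_map (μ := limitLaw β₁ c vε vη vεη) hm.aemeasurable
  have hq : 0 ≤ a ^ 2 * vε + 2 * a * (β₁ * a + b) * vεη + (β₁ * a + b) ^ 2 * vη := by
    have := hS.dotProduct_mulVec_nonneg ![a, b]
    rw [star_trivial, dotProduct_asympCov_mulVec] at this
    simpa using this
  refine Measure.ext_of_charFun (funext fun s => ?_)
  have h1 : charFun ((limitLaw β₁ c vε vη vεη).map fun v => a * v 0 + b * v 1) s =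
      charFun (limitLaw β₁ c vε vη vεη) (!₂[s * a, s * b]) := by
    rw [charFun_apply, charFun_apply, integral_map hm.aemeasurable (by fun_prop)]
    refine integral_congr_ae (Eventually.of_forall fun v => ?_)
    simp [PiLp.inner_apply, Fin.sum_univ_two]
    ring_nf
  rw [h1, charFun_limitLaw hS, charFun_gaussianReal, ← Complex.exp_add, Real.coe_toNNReal _ hq]
  congr 1
  simp
  ring

lemma gaussianReal_singleton_eq_zero {m x : ℝ} {v : NNReal} (h : v ≠ 0 ∨ m ≠ x) :
    gaussianReal m v {x} = 0 := by
  rcases eq_or_ne v 0 with rfl | hv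
  · rw [gaussianReal_zero_var]
    have : m ≠ x := by simpa using h
    simp [this]
  · have := nullSingletonClass_gaussianReal (μ := m) hv
    exact measure_singleton x

lemma limitLaw_linear_eq_zero {β₁ c vε vη vεη : ℝ} (hS : (asympCov β₁ vε vη vεη).PosSemidef)
    {a b : ℝ} (h : 0 < a ^ 2 * vε + 2 * a * (β₁ * a + b) * vεη + (β₁ * a + b) ^ 2 * vη ∨
      (β₁ * a + b) * c ≠ 0) :
    limitLaw β₁ c vε vη vεη {v | a * v 0 + b * v 1 = 0} = 0 := by
  have hm : Measurable fun v : EuclideanSpace ℝ (Fin 2) => a * v 0 + b * v 1 := by fun_prop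
  have h1 : limitLaw β₁ c vε vη vεη {v | a * v 0 + b * v 1 = 0} =
      (limitLaw β₁ c vε vη vεη).map (fun v => a * v 0 + b * v 1) {0} :=
    (Measure.map_apply hm (measurableSet_singleton 0)).symm
  rw [h1, limitLaw_map_linear hS]
  exact gaussianReal_singleton_eq_zero (h.imp_left fun h => by simpa using h)

lemma limitLaw_snd_eq_zero {β₁ c vε vη vεη : ℝ} (hS : (asympCov β₁ vε vη vεη).PosSemidef)
    (h : 0 < vη ∨ c ≠ 0) : limitLaw β₁ c vε vη vεη {v | v 1 = 0} = 0 := by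
  have := limitLaw_linear_eq_zero (c := c) hS (a := 0) (b := 1) (by simpa using h)
  simpa using this

/-- Off `v 1 = 0` the event is `v 0 - β₁ * v 1 = 0`, and this linear form has variance `vε`. -/
lemma limitLaw_ratio_eq {β₁ c vε vη vεη : ℝ} (hS : (asympCov β₁ vε vη vεη).PosSemidef)
    (hε : 0 < vε) (h : 0 < vη ∨ c ≠ 0) :
    limitLaw β₁ c vε vη vεη {v | v 0 / v 1 = β₁} = 0 := by
  have h1 := limitLaw_linear_eq_zero (c := c) hS (a := 1) (b := -β₁) (by left; simpa using hε)
  refine measure_mono_null (fun v hv => ?_)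
    (measure_union_null (limitLaw_snd_eq_zero (c := c) hS h) h1)
  by_cases hv1 : v 1 = 0
  · exact Or.inl hv1
  · have hv' : v 0 / v 1 = β₁ := hv
    rw [div_eq_iff hv1] at hv'
    right
    change 1 * v 0 + -β₁ * v 1 = 0
    rw [hv']; ring

/-- For `c = 0` the limiting law is a linear image of two independent standard normals. -/
lemma limitLaw_eq_map_prod {β₁ vε vη vεη : ℝ} (hS : (asympCov β₁ vε vη vεη).PosSemidef)
    (hη : 0 < vη) (h : vεη ^ 2 < vε * vη) :
    limitLaw β₁ 0 vε vη vεη = ((gaussianReal 0 1).prod (gaussianReal 0 1)).map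
      (fun p : ℝ × ℝ => (!₂[(β₁ + vεη / vη) * √vη * p.1 + √(vε * vη - vεη ^ 2) / √vη * p.2,
        √vη * p.1] : EuclideanSpace ℝ (Fin 2))) := by
  have hm : Measurable (fun p : ℝ × ℝ =>
      (!₂[(β₁ + vεη / vη) * √vη * p.1 + √(vε * vη - vεη ^ 2) / √vη * p.2,
        √vη * p.1] : EuclideanSpace ℝ (Fin 2))) := by
    refine (WithLp.measurable_toLp 2 (Fin 2 → ℝ)).comp (measurable_pi_iff.2 fun i => ?_)
    fin_cases i <;> simp <;> fun_prop
  have := Measure.isProbabilityMeasure_map (μ := (gaussianReal 0 1).prod (gaussianReal 0 1))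
    hm.aemeasurable
  refine Measure.ext_of_charFun (funext fun t => ?_)
  set s := √vη with hs
  have hs0 : 0 < s := Real.sqrt_pos.2 hη
  have hss : s ^ 2 = vη := Real.sq_sqrt hη.le
  set r := √(vε * vη - vεη ^ 2) with hr
  have hrr : r ^ 2 = vε * vη - vεη ^ 2 := Real.sq_sqrt (by linarith)
  have hsplit : ∀ p : ℝ × ℝ, Complex.exp (inner ℝ
      (!₂[(β₁ + vεη / vη) * s * p.1 + r / s * p.2, s * p.1] : EuclideanSpace ℝ (Fin 2)) t *
        Complex.I) =
      Complex.exp ((((β₁ + vεη / vη) * s * t 0 + s * t 1 : ℝ) : ℂ) * p.1 * Complex.I) *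
        Complex.exp (((r / s * t 0 : ℝ) : ℂ) * p.2 * Complex.I) := by
    intro p
    rw [← Complex.exp_add]
    congr 1
    simp [PiLp.inner_apply, Fin.sum_univ_two]
    ring
  rw [charFun_limitLaw hS, charFun_apply, integral_map hm.aemeasurable (by fun_prop)]
  simp_rw [hsplit]
  rw [integral_prod_mul (fun x : ℝ =>
      Complex.exp ((((β₁ + vεη / vη) * s * t 0 + s * t 1 : ℝ) : ℂ) * x * Complex.I))
    (fun y : ℝ => Complex.exp (((r / s * t 0 : ℝ) : ℂ) * y * Complex.I)),
    ← charFun_apply_real, ← charFun_apply_real, charFun_gaussianReal, charFun_gaussianReal,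
    ← Complex.exp_add, ← Complex.exp_add]
  congr 1
  -- Completing the square: `β₁ + vεη / vη` is the slope of `V₀` on `V₁`, and `r² / s²` the residual
  -- variance.
  have key : t 0 ^ 2 * vε + 2 * t 0 * (β₁ * t 0 + t 1) * vεη + (β₁ * t 0 + t 1) ^ 2 * vη =
      ((β₁ + vεη / vη) * s * t 0 + s * t 1) ^ 2 + (r / s * t 0) ^ 2 := by
    have : ((β₁ + vεη / vη) * s * t 0 + s * t 1) ^ 2 + (r / s * t 0) ^ 2 =
      s ^ 2 * ((β₁ + vεη / vη) * t 0 + t 1) ^ 2 + r ^ 2 / s ^ 2 * t 0 ^ 2 := by ring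
    rw [this, hss, hrr]
    field_simp
    ring
  rw [key]
  push_cast
  ring

lemma limitLaw_ratio_cauchy {β₁ vε vη vεη : ℝ} (hS : (asympCov β₁ vε vη vεη).PosSemidef)
    (hη : 0 < vη) (h : vεη ^ 2 < vε * vη) :
    (limitLaw β₁ 0 vε vη vεη).map (fun v => v 0 / v 1) =
      cauchyMeasure (β₁ + vεη / vη) (√(vε * vη - vεη ^ 2) / vη).toNNReal := by
  have hr : 0 < √(vε * vη - vεη ^ 2) := Real.sqrt_pos.2 (by linarith)
  have hs0 : 0 < √vη := Real.sqrt_pos.2 hη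
  have hss : √vη * √vη = vη := Real.mul_self_sqrt hη.le
  rw [← map_ratio_gaussianReal_prod _ (div_pos hr hη), limitLaw_eq_map_prod hS hη h,
    Measure.map_map (by fun_prop) ?_]
  swap
  · refine (WithLp.measurable_toLp 2 (Fin 2 → ℝ)).comp (measurable_pi_iff.2 fun i => ?_)
    fin_cases i <;> simp <;> fun_prop
  refine Measure.map_congr ?_
  have hne : ∀ᵐ p : ℝ × ℝ ∂(gaussianReal 0 1).prod (gaussianReal 0 1), p.1 ≠ 0 := by
    have h0 : ∀ᵐ y ∂gaussianReal 0 1, y ≠ 0 :=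
      compl_mem_ae_iff.2 (gaussianReal_singleton_eq_zero (Or.inl one_ne_zero))
    exact Measure.quasiMeasurePreserving_fst.ae h0
  filter_upwards [hne] with p hp
  simp only [Function.comp_apply, Matrix.cons_val_zero, Matrix.cons_val_one]
  generalize √(vε * vη - vεη ^ 2) = r
  generalize √vη = s at *
  rw [← hss]
  field_simp

/-! ### Joint asymptotic normality -/

section Sample

variable {Ω : Type*} {β₀ β₁ π₀ c : ℝ} {Z : ℕ → ℝ} {ε η : ℕ → Ω → ℝ}
  {cov : ℕ → (ℕ → ℝ) → (ℕ → ℝ) → ℝ} {w : ℕ → ℕ → ℝ}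

lemma cov_regressor (hw : ∀ n x, cov n x Z = (∑ i ∈ Finset.range n, w n i * x i) / n)
    (hπ : ∀ n, π₀ * ∑ i ∈ Finset.range n, w n i = 0) (n : ℕ) (ω : Ω) :
    cov n (regressor π₀ c Z η n ω) Z =
      c / √(n : ℝ) * cov n Z Z + (∑ i ∈ Finset.range n, w n i * η i ω) / n := by
  rw [hw, hw n Z, mul_div_assoc', ← add_div, Finset.mul_sum, ← Finset.sum_add_distrib]
  congr 1
  rw [← sub_eq_zero, ← hπ n, Finset.mul_sum, ← Finset.sum_sub_distrib]
  refine Finset.sum_congr rfl fun i _ => ?_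
  simp only [regressor]
  ring

lemma cov_outcome (hw : ∀ n x, cov n x Z = (∑ i ∈ Finset.range n, w n i * x i) / n)
    (hβ : ∀ n, β₀ * ∑ i ∈ Finset.range n, w n i = 0) (n : ℕ) (ω : Ω) :
    cov n (outcome β₀ β₁ π₀ c Z ε η n ω) Z =
      β₁ * cov n (regressor π₀ c Z η n ω) Z + (∑ i ∈ Finset.range n, w n i * ε i ω) / n := by
  rw [hw, hw n (regressor π₀ c Z η n ω), mul_div_assoc', ← add_div, Finset.mul_sum,
    ← Finset.sum_add_distrib]
  congr 1
  rw [← sub_eq_zero, ← hβ n, Finset.mul_sum, ← Finset.sum_sub_distrib]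
  refine Finset.sum_congr rfl fun i _ => ?_
  simp only [outcome]
  ring

/-- Splits a projection into drift and weighted i.i.d. sum; the `√n` cancels the `1 / √n` of the
weak first stage. -/
lemma inner_sqrt_smul_cov
    (hw : ∀ n x, cov n x Z = (∑ i ∈ Finset.range n, w n i * x i) / n)
    (hβ : ∀ n, β₀ * ∑ i ∈ Finset.range n, w n i = 0)
    (hπ : ∀ n, π₀ * ∑ i ∈ Finset.range n, w n i = 0) {n : ℕ} (hn : n ≠ 0) (ω : Ω)
    (t : EuclideanSpace ℝ (Fin 2)) :
    inner ℝ (√(n : ℝ) • (!₂[cov n (outcome β₀ β₁ π₀ c Z ε η n ω) Z,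
      cov n (regressor π₀ c Z η n ω) Z] : EuclideanSpace ℝ (Fin 2))) t =
      (β₁ * t 0 + t 1) * (c * cov n Z Z) +
        ∑ i ∈ Finset.range n, w n i / √(n : ℝ) * (t 0 * ε i ω + (β₁ * t 0 + t 1) * η i ω) := by
  have hs : √(n : ℝ) ≠ 0 := (Real.sqrt_pos.2 (by positivity)).ne'
  have hss : √(n : ℝ) * √(n : ℝ) = n := Real.mul_self_sqrt (by positivity)
  have hsum : ∑ i ∈ Finset.range n, w n i / √(n : ℝ) *
      (t 0 * ε i ω + (β₁ * t 0 + t 1) * η i ω) =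
      (t 0 * (∑ i ∈ Finset.range n, w n i * ε i ω) +
        (β₁ * t 0 + t 1) * ∑ i ∈ Finset.range n, w n i * η i ω) / √(n : ℝ) := by
    rw [Finset.mul_sum, Finset.mul_sum, ← Finset.sum_add_distrib, Finset.sum_div]
    refine Finset.sum_congr rfl fun i _ => ?_
    ring
  rw [hsum]
  simp only [PiLp.inner_apply, Fin.sum_univ_two, PiLp.smul_apply, Matrix.cons_val_zero,
    Matrix.cons_val_one, smul_eq_mul, RCLike.inner_apply, conj_trivial]
  rw [cov_outcome hw hβ, cov_regressor hw hπ]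
  generalize ∑ i ∈ Finset.range n, w n i * ε i ω = A
  generalize ∑ i ∈ Finset.range n, w n i * η i ω = B
  generalize cov n Z Z = C
  generalize √(n : ℝ) = s at *
  rw [← hss]
  field_simp
  ring

variable [MeasurableSpace Ω] {P : Measure Ω} [IsProbabilityMeasure P]

lemma integral_sq_linear_combination {X Y : Ω → ℝ} (hX : MemLp X 2 P) (hY : MemLp Y 2 P)
    (hX0 : ∫ ω, X ω ∂P = 0) (hY0 : ∫ ω, Y ω ∂P = 0) (p q : ℝ) :
    ∫ ω, (p * X ω + q * Y ω) ^ 2 ∂P =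
      p ^ 2 * Var[X; P] + 2 * p * q * cov[X, Y; P] + q ^ 2 * Var[Y; P] := by
  rw [covariance_eq_sub hX hY, hX0, hY0,
    variance_of_integral_eq_zero hX.aestronglyMeasurable.aemeasurable hX0,
    variance_of_integral_eq_zero hY.aestronglyMeasurable.aemeasurable hY0]
  have h : ∀ ω, (p * X ω + q * Y ω) ^ 2 =
      p ^ 2 * X ω ^ 2 + 2 * p * q * (X ω * Y ω) + q ^ 2 * Y ω ^ 2 := fun ω => by ring
  simp_rw [h]
  have h1 : Integrable (fun ω => p ^ 2 * X ω ^ 2) P := hX.integrable_sq.const_mul _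
  have h2 : Integrable (fun ω => q ^ 2 * Y ω ^ 2) P := hY.integrable_sq.const_mul _
  have h3 : Integrable (fun ω => 2 * p * q * (X ω * Y ω)) P := (hX.integrable_mul hY).const_mul _
  have h13 : Integrable (fun ω => p ^ 2 * X ω ^ 2 + 2 * p * q * (X ω * Y ω)) P := h1.add h3
  rw [integral_add h13 h2, integral_add h1 h3, integral_const_mul, integral_const_mul,
    integral_const_mul]
  simp [Pi.mul_apply]

lemma asympCov_posSemidef_of_errors {X Y : Ω → ℝ} (hX : MemLp X 2 P) (hY : MemLp Y 2 P)
    (hX0 : ∫ ω, X ω ∂P = 0) (hY0 : ∫ ω, Y ω ∂P = 0) (β₁ : ℝ) :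
    (asympCov β₁ Var[X; P] Var[Y; P] cov[X, Y; P]).PosSemidef :=
  asympCov_posSemidef fun p q => by
    rw [← integral_sq_linear_combination hX hY hX0 hY0]
    exact integral_nonneg fun ω => sq_nonneg _

theorem tendstoInDistribution_sqrt_smul_cov
    (hindep : iIndepFun (fun i ω => (ε i ω, η i ω)) P)
    (hident : ∀ i, IdentDistrib (fun ω => (ε i ω, η i ω)) (fun ω => (ε 0 ω, η 0 ω)) P P)
    (hε : MemLp (ε 0) 2 P) (hη : MemLp (η 0) 2 P)
    (hε0 : ∫ ω, ε 0 ω ∂P = 0) (hη0 : ∫ ω, η 0 ω ∂P = 0)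
    (hZ : Tendsto (fun n => cov n Z Z) atTop (𝓝 1))
    (hw : ∀ n x, cov n x Z = (∑ i ∈ Finset.range n, w n i * x i) / n)
    (hwZ : ∀ n, cov n Z Z = (∑ i ∈ Finset.range n, w n i ^ 2) / n)
    (hβ : ∀ n, β₀ * ∑ i ∈ Finset.range n, w n i = 0)
    (hπ : ∀ n, π₀ * ∑ i ∈ Finset.range n, w n i = 0)
    (hmax : ∀ δ > 0, ∀ᶠ n : ℕ in atTop, ∀ i < n, |w n i| ≤ δ * √(n : ℝ)) :
    TendstoInDistribution
      (fun (n : ℕ) ω => √(n : ℝ) • (!₂[cov n (outcome β₀ β₁ π₀ c Z ε η n ω) Z,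
        cov n (regressor π₀ c Z η n ω) Z] : EuclideanSpace ℝ (Fin 2)))
      atTop id (fun _ => P)
      (limitLaw β₁ c Var[ε 0; P] Var[η 0; P] cov[ε 0, η 0; P]) := by
  have hmε : ∀ i, AEMeasurable (ε i) P := fun i =>
    measurable_fst.comp_aemeasurable (hident i).aemeasurable_fst
  have hmη : ∀ i, AEMeasurable (η i) P := fun i =>
    measurable_snd.comp_aemeasurable (hident i).aemeasurable_fst
  have hmX : ∀ n : ℕ, AEMeasurable (fun ω =>
      √(n : ℝ) • (!₂[cov n (outcome β₀ β₁ π₀ c Z ε η n ω) Z,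
        cov n (regressor π₀ c Z η n ω) Z] : EuclideanSpace ℝ (Fin 2))) P := by
    intro n
    suffices h : AEMeasurable (fun ω => (!₂[cov n (outcome β₀ β₁ π₀ c Z ε η n ω) Z,
        cov n (regressor π₀ c Z η n ω) Z] : EuclideanSpace ℝ (Fin 2))) P from
      h.const_smul √(n : ℝ)
    refine (WithLp.measurable_toLp 2 (Fin 2 → ℝ)).comp_aemeasurable
      (aemeasurable_pi_iff.2 fun i => ?_)
    simp only [cov_outcome hw hβ, cov_regressor hw hπ]
    fin_cases i <;> simp <;> fun_prop
  refine ⟨hmX, aemeasurable_id, ?_⟩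
  refine ProbabilityMeasure.tendsto_iff_tendsto_charFun.2 fun t => ?_
  simp only [ProbabilityMeasure.coe_mk, Measure.map_id]
  rw [charFun_limitLaw (asympCov_posSemidef_of_errors hε hη hε0 hη0 β₁),
    ← integral_sq_linear_combination hε hη hε0 hη0]
  have hlin : Measurable fun x : ℝ × ℝ => t 0 * x.1 + (β₁ * t 0 + t 1) * x.2 := by fun_prop
  have hclt := tendsto_charFun_weighted_sum (P := P)
    (ξ := fun i ω => t 0 * ε i ω + (β₁ * t 0 + t 1) * η i ω)
    (a := fun n i => w n i / √(n : ℝ))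
    (hindep.comp (fun _ => fun x : ℝ × ℝ => t 0 * x.1 + (β₁ * t 0 + t 1) * x.2) fun _ => hlin)
    (fun i => (hident i).comp hlin)
    ((hε.const_mul _).add (hη.const_mul _))
    (by
      rw [integral_add ((hε.integrable one_le_two).const_mul _)
        ((hη.integrable one_le_two).const_mul _), integral_const_mul, integral_const_mul, hε0, hη0]
      simp)
    (by
      refine hZ.congr fun n => ?_
      rw [hwZ, Finset.sum_div]
      refine Finset.sum_congr rfl fun i _ => ?_
      rw [div_pow, Real.sq_sqrt (by positivity)])
    (by
      intro δ hδ
      filter_upwards [hmax δ hδ, eventually_gt_atTop 0] with n hn hn0 i hi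
      have hs : 0 < √(n : ℝ) := Real.sqrt_pos.2 (by exact_mod_cast hn0)
      rw [abs_div, abs_of_pos hs, div_le_iff₀ hs]
      exact hn i hi)
  have hphase : Tendsto (fun n => Complex.exp (((β₁ * t 0 + t 1) * (c * cov n Z Z) : ℝ) *
      Complex.I)) atTop (𝓝 (Complex.exp (((β₁ * t 0 + t 1) * c : ℝ) * Complex.I))) := by
    have hc : Continuous fun s : ℝ =>
        Complex.exp (((β₁ * t 0 + t 1) * (c * s) : ℝ) * Complex.I) := by fun_prop
    have := (hc.tendsto 1).comp hZ
    rwa [mul_one] at this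
  refine (hphase.mul hclt).congr' ?_
  filter_upwards [eventually_ne_atTop 0] with n hn
  conv_rhs => rw [charFun_apply, integral_map (hmX n) (by fun_prop)]
  rw [charFun_apply_real, integral_map
    (Finset.aemeasurable_fun_sum _ fun i _ => by fun_prop) (by fun_prop), ← integral_const_mul]
  refine integral_congr_ae (Eventually.of_forall fun ω => ?_)
  simp only
  rw [inner_sqrt_smul_cov hw hβ hπ hn, ← Complex.exp_add]
  congr 1
  push_cast
  ring

/-! ### The estimator -/

lemma twoSLS_eq_ratio (hw : ∀ n x, cov n x Z = (∑ i ∈ Finset.range n, w n i * x i) / n)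
    (n : ℕ) (Y D : ℕ → ℝ) :
    twoSLS cov n Y D Z = (√(n : ℝ) • (!₂[cov n Y Z, cov n D Z] : EuclideanSpace ℝ (Fin 2))) 0 /
      (√(n : ℝ) • (!₂[cov n Y Z, cov n D Z] : EuclideanSpace ℝ (Fin 2))) 1 := by
  simp only [twoSLS, PiLp.smul_apply, Matrix.cons_val_zero, Matrix.cons_val_one,
    smul_eq_mul]
  rcases eq_or_ne n 0 with rfl | hn
  · simp [hw]
  · rw [mul_div_mul_left _ _ (Real.sqrt_pos.2 (by positivity)).ne']

end Sample

end WeakIV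

theorem mainTheorem5
    {Ω : Type*} [MeasurableSpace Ω] (P : Measure Ω) [IsProbabilityMeasure P]
    (β₀ β₁ π₀ c : ℝ)
    -- the fixed instruments and the i.i.d. pairs of structural and first-stage errors
    (Z : ℕ → ℝ) (ε η : ℕ → Ω → ℝ)
    (hindep : iIndepFun (fun i ω => (ε i ω, η i ω)) P)
    (hident : ∀ i, IdentDistrib (fun ω => (ε i ω, η i ω)) (fun ω => (ε 0 ω, η 0 ω)) P P)
    (hε : MemLp (ε 0) 2 P) (hη : MemLp (η 0) 2 P)
    (hε0 : ∫ ω, ε 0 ω ∂P = 0) (hη0 : ∫ ω, η 0 ω ∂P = 0)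
    -- centred covariances, or, in the model without intercepts, uncentred ones
    (cov : ℕ → (ℕ → ℝ) → (ℕ → ℝ) → ℝ)
    (hcov : cov = WeakIV.sampleCov ∨ (cov = WeakIV.sampleMoment ∧ β₀ = 0 ∧ π₀ = 0))
    (hZ : Tendsto (fun n => cov n Z Z) atTop (𝓝 1))
    (vε vη vεη : ℝ)
    (hvε : vε = Var[ε 0; P]) (hvη : vη = Var[η 0; P]) (hvεη : vεη = cov[ε 0, η 0; P])
    (D Y : ℕ → Ω → ℕ → ℝ)
    (hD : D = WeakIV.regressor π₀ c Z η) (hY : Y = WeakIV.outcome β₀ β₁ π₀ c Z ε η) :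
    -- joint asymptotic normality
    ((WeakIV.asympCov β₁ vε vη vεη).PosSemidef ∧
      TendstoInDistribution
        (fun (n : ℕ) ω => √(n : ℝ) • (!₂[cov n (Y n ω) Z, cov n (D n ω) Z] : EuclideanSpace ℝ (Fin 2)))
        atTop id (fun _ => P) (WeakIV.limitLaw β₁ c vε vη vεη)) ∧
    -- convergence of the estimator to a ratio of jointly normal variables; the estimator and the
    -- limiting ratio are well defined with probability tending to one, resp. almost surely
    (0 < vη ∨ c ≠ 0 →
      Tendsto (fun n => P {ω | cov n (D n ω) Z = 0}) atTop (𝓝 0) ∧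
      WeakIV.limitLaw β₁ c vε vη vεη {v | v 1 = 0} = 0 ∧
      TendstoInDistribution (fun n ω => WeakIV.twoSLS cov n (Y n ω) (D n ω) Z)
        atTop (fun v => v 0 / v 1) (fun _ => P) (WeakIV.limitLaw β₁ c vε vη vεη)) ∧
    -- for `c = 0` the limit is a Cauchy distribution
    (c = 0 → vεη ^ 2 < vε * vη →
      (WeakIV.limitLaw β₁ c vε vη vεη).map (fun v => v 0 / v 1) =
        cauchyMeasure (β₁ + vεη / vη) (√(vε * vη - vεη ^ 2) / vη).toNNReal) ∧
    -- divergence of the rescaled estimation error: it escapes to infinity in absolute value, in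
    -- probability, and has no limit in distribution
    (0 < vε → 0 < vη ∨ c ≠ 0 →
      (∀ M : ℝ, Tendsto
        (fun (n : ℕ) => P {ω | |√(n : ℝ) * (WeakIV.twoSLS cov n (Y n ω) (D n ω) Z - β₁)| ≤ M})
        atTop (𝓝 0)) ∧
      ∀ (ν : Measure ℝ) [IsProbabilityMeasure ν], ¬ TendstoInDistribution
        (fun (n : ℕ) ω => √(n : ℝ) * (WeakIV.twoSLS cov n (Y n ω) (D n ω) Z - β₁))
        atTop id (fun _ => P) ν) := by
  obtain ⟨w, hw, hwZ, hβ, hπ, hmax⟩ := WeakIV.exists_weights hcov hZ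
  subst hvε hvη hvεη hD hY
  have hS := WeakIV.asympCov_posSemidef_of_errors hε hη hε0 hη0 β₁
  have hclt := WeakIV.tendstoInDistribution_sqrt_smul_cov (β₁ := β₁) (c := c) hindep hident hε hη
    hε0 hη0 hZ hw hwZ hβ hπ hmax
  have hC : IsClosed {v : EuclideanSpace ℝ (Fin 2) | v 1 = 0} :=
    isClosed_eq (by fun_prop) continuous_const
  have hratio : 0 < Var[η 0; P] ∨ c ≠ 0 →
      TendstoInDistribution (fun n ω => WeakIV.twoSLS cov n
        (WeakIV.outcome β₀ β₁ π₀ c Z ε η n ω) (WeakIV.regressor π₀ c Z η n ω) Z)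
        atTop (fun v => v 0 / v 1) (fun _ => P)
        (WeakIV.limitLaw β₁ c Var[ε 0; P] Var[η 0; P] cov[ε 0, η 0; P]) := by
    intro h
    have hg : ContinuousOn (fun v : EuclideanSpace ℝ (Fin 2) => v 0 / v 1) {v | v 1 = 0}ᶜ :=
      ContinuousOn.div (by fun_prop) (by fun_prop) fun v hv => hv
    have := WeakIV.TendstoInDistribution.comp_of_continuousOn hclt
      (g := fun v : EuclideanSpace ℝ (Fin 2) => v 0 / v 1) (by fun_prop) hC.isOpen_compl hg
      (by rw [compl_compl]; exact WeakIV.limitLaw_snd_eq_zero hS h)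
    simp only [WeakIV.twoSLS_eq_ratio hw]
    exact this
  refine ⟨⟨hS, hclt⟩, fun h => ⟨?_, WeakIV.limitLaw_snd_eq_zero hS h, hratio h⟩, ?_, ?_⟩
  -- A vanishing denominator puts the scaled vector in the closed set `v 1 = 0`, which is null in
  -- the limit.
  · refine tendsto_of_tendsto_of_tendsto_of_le_of_le tendsto_const_nhds
      (WeakIV.tendsto_measure_preimage_zero_of_isClosed hclt hC
        (WeakIV.limitLaw_snd_eq_zero hS h)) (fun _ => zero_le) fun n => measure_mono fun ω hω => ?_
    have hω' : cov n (WeakIV.regressor π₀ c Z η n ω) Z = 0 := hω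
    simp [hω']
  · rintro rfl h
    -- The strict inequality already excludes a degenerate `η`.
    have hη' : 0 < Var[η 0; P] := by
      refine (variance_nonneg _ _).lt_of_ne fun h0 => ?_
      rw [← h0, mul_zero] at h
      exact absurd h (sq_nonneg _).not_gt
    exact WeakIV.limitLaw_ratio_cauchy hS hη' h
  · intro h1 h2
    have hesc := WeakIV.tendsto_measure_abs_sqrt_mul_sub_le (hratio h2)
      (WeakIV.limitLaw_ratio_eq hS h1 h2)
    exact ⟨hesc, fun ν _ => WeakIV.not_tendstoInDistribution_of_escape hesc ν⟩
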